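/- Let $(X,Y)$ be a pair of random variables with joint law $p$, where $Y$ takes values in a countable set containing a distinguished outcome $0$, $H(Y)<\infty$, and $Y=f(X)$ almost surely for a measurable function $f$. (This covers classification, $Y\in\{0,\dots,m\}$.) A *bottleneck variable* is a random variable $T$, with values in an arbitrary measurable space and jointly distributed with $(X,Y)$, such that $Y-X-T$ is a Markov chain ($Y$ and $T$ are conditionally independent given $X$). For $\beta\in[0,1]$ the *IB Lagrangian* is $\mathcal L_\beta(T)=I(Y;T)-\beta I(X;T)$ (equal to $-\infty$ if $\beta>0$ and $I(X;T)=\infty$, and to $I(Y;T)$ if $\beta=0$); a *maximizer* for $\beta$ is a bottleneck variable that maximizes $\mathcal L_\beta$ over all bottleneck variables. Let $F(r)=\sup\{I(Y;T): T \text{ a bottleneck variable},\ I(X;T)\le r\}$; the *IB curve* is the graph of $F$ over $0\le r<\infty$, and $T$ *lies on the IB curve* if $I(Y;T)=F(I(X;T))$. Let $T_{\mathrm{copy}}=f(X)$, and for $\alpha\in[0,1]$ let $T_\alpha=B_\alpha\cdot f(X)$, where $B_\alpha\in\{0,1\}$ is independent of $(X,Y)$ and $P(B_\alpha=1)=\alpha$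 (so $T_\alpha$ is $f(X)$ if $B_\alpha=1$ and $0$ if $B_\alpha=0$). Then: 1. $F(r)=\min(r,H(Y))$ for all $r\ge 0$. Call the part of the curve over $0\le r\le H(Y)$ its increasing part, and the part over $r\ge H(Y)$ its flat part. 2. $I(X;T_{\mathrm{copy}})=I(Y;T_{\mathrm{copy}})=H(Y)$, and for every $\beta\in[0,1]$, $T_{\mathrm{copy}}$ is a maximizer, with $\mathcal L_\beta(T_{\mathrm{copy}})=(1-\beta)H(Y)$. Likewise every one-to-one transformation $g(T_{\mathrm{copy}})$ (with values in a measurable space whose singletons are measurable) has $I(X;g(T_{\mathrm{copy}}))=I(Y;g(T_{\mathrm{copy}}))=H(Y)$ and is a maximizer for every $\beta\in[0,1]$. For $\beta\in(0,1)$, the point $\langle H(Y),H(Y)\rangle$ is the only value of $\langle I(X;T),I(Y;T)\rangle$ attained by maximizers. 3. For $\beta=1$, a bottleneck variable $T$ is a maximizer if and only if $I(X;T)=I(Y;T)$. In particular every $T$ on the increasing part of the IB curve (that is, $T$ lies on the IB curve and $I(X;T)\le H(Y)$) is a maximizer. Every $T_\alpha$ lies on the IB curve and is a maximizer; the points $\langle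 I(X;T_\alpha),I(Y;T_\alpha)\rangle$, $\alpha\in[0,1]$, form exactly the increasing part of the curve, so every point of that part is attained by a maximizer. 4. For $\beta=0$, a bottleneck variable $T$ is a maximizer if and only if $I(Y;T)=H(Y)$. In particular every $T$ on the flat part of the IB curve ($T$ lies on the IB curve and $I(X;T)\ge H(Y)$) is a maximizer. 5. Hence there is no one-to-one correspondence between $\beta$ and points on the IB curve: there is no injective map $\beta\mapsto z(\beta)$ on $[0,1]$ such that each $z(\beta)$ is a value of $\langle I(X;T),I(Y;T)\rangle$ for some maximizer $T$ for $\beta$; and, if $H(Y)>0$, there is no injective map $z\mapsto b(z)\in[0,1]$ on the increasing part of the curve such that each $z$ is a value of $\langle I(X;T),I(Y;T)\rangle$ for some maximizer $T$ for $b(z)$. -/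

import Mathlib

open MeasureTheory ProbabilityTheory InformationTheory Set
open scoped ENNReal

universe u

namespace IB

noncomputable section

/-- Mutual information (in nats) of the random variables `U`, `V` on `(Ω, μ)`: the
Kullback-Leibler divergence of the joint law from the product of the marginal laws. -/
def mutualInfo {Ω A B : Type*} [MeasurableSpace Ω] [MeasurableSpace A] [MeasurableSpace B]
    (μ : Measure Ω) (U : Ω → A) (V : Ω → B) : ℝ≥0∞ :=
  klDiv (μ.map fun w => (U w, V w)) ((μ.map U).prod (μ.map V))

/-- Shannon entropy (in nats) of a discrete random variable `U` on `(Ω, μ)`. -/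
def entropy {Ω A : Type*} [MeasurableSpace Ω] [MeasurableSpace A]
    (μ : Measure Ω) (U : Ω → A) : ℝ≥0∞ :=
  ∑' a : A, ENNReal.ofReal (Real.negMulLog ((μ.map U).real {a}))

variable {X Y T : Type u} [MeasurableSpace X] [MeasurableSpace Y] [MeasurableSpace T]

/-- `q`, the joint law of `(X, Y, T)`, makes `T` a bottleneck variable for the joint law `p` of
`(X, Y)`: the `(X, Y)`-marginal of `q` is `p`, and `Y - X - T` is a Markov chain, i.e. `Y` and `T`
are conditionally independent given `X`. (On standard Borel spaces this agrees with
`ProbabilityTheory.CondIndepFun`; see `ProbabilityTheory.condIndep_iff`.) -/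
structure IsBottleneck (p : Measure (X × Y)) (q : Measure (X × Y × T)) : Prop where
  marginal : q.map (fun w => (w.1, w.2.1)) = p
  markov : ∀ (B : Set Y) (C : Set T), MeasurableSet B → MeasurableSet C →
    q⟦{w | w.2.1 ∈ B} ∩ {w | w.2.2 ∈ C} | MeasurableSpace.comap Prod.fst inferInstance⟧ =ᵐ[q]
      q⟦{w | w.2.1 ∈ B} | MeasurableSpace.comap Prod.fst inferInstance⟧ *
        q⟦{w | w.2.2 ∈ C} | MeasurableSpace.comap Prod.fst inferInstance⟧

/-- The compression term `I(X;T)`. -/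
def infoXT (q : Measure (X × Y × T)) : ℝ≥0∞ := mutualInfo q (fun w => w.1) (fun w => w.2.2)

/-- The prediction term `I(Y;T)`. -/
def infoYT (q : Measure (X × Y × T)) : ℝ≥0∞ := mutualInfo q (fun w => w.2.1) (fun w => w.2.2)

/-- The point `⟨I(X;T), I(Y;T)⟩` of the information plane. -/
def infoPoint (q : Measure (X × Y × T)) : ℝ≥0∞ × ℝ≥0∞ := (infoXT q, infoYT q)

/-- The entropy `H(Y)`. -/
def entropyY (p : Measure (X × Y)) : ℝ≥0∞ := entropy p Prod.snd

/-- The IB Lagrangian `I(Y;T) - β I(X;T)`, as an extended real number: if `I(X;T) = ∞` and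
`I(Y;T) < ∞` it is `-∞` for `β > 0`, and it is `I(Y;T)` for `β = 0`. -/
def lagrangian (β : ℝ) (q : Measure (X × Y × T)) : EReal :=
  (infoYT q : EReal) - (β : EReal) * (infoXT q : EReal)

/-- The bottleneck variable `T` (given through `q`) maximizes the IB Lagrangian over all bottleneck
variables, whatever their space of outcomes. -/
def IsMaximizer (p : Measure (X × Y)) (β : ℝ) (q : Measure (X × Y × T)) : Prop :=
  IsBottleneck p q ∧
    ∀ (T' : Type u) [MeasurableSpace T'] (q' : Measure (X × Y × T')),
      IsBottleneck p q' → lagrangian β q' ≤ lagrangian β q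

/-- `F(r)`, the supremum of `I(Y;T)` over all bottleneck variables with `I(X;T) ≤ r`. -/
def curveFun (p : Measure (X × Y)) (r : ℝ≥0∞) : ℝ≥0∞ :=
  ⨆ (T' : Type u) (_ : MeasurableSpace T') (q : Measure (X × Y × T'))
    (_ : IsBottleneck p q) (_ : infoXT q ≤ r), infoYT q

/-- The IB curve in the information plane: the graph of `F` over `0 ≤ r < ∞`. -/
def curve (p : Measure (X × Y)) : Set (ℝ≥0∞ × ℝ≥0∞) :=
  {z | z.1 ≠ ∞ ∧ z.2 = curveFun p z.1}

/-- The part of the IB curve over `0 ≤ r ≤ H(Y)`. -/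
def increasingPart (p : Measure (X × Y)) : Set (ℝ≥0∞ × ℝ≥0∞) :=
  {z | z ∈ curve p ∧ z.1 ≤ entropyY p}

/-- The bottleneck variable `T` (given through `q`) is optimal for its own amount of compression. -/
def OnCurve (p : Measure (X × Y)) (q : Measure (X × Y × T)) : Prop :=
  IsBottleneck p q ∧ infoYT q = curveFun p (infoXT q)

/-- The points of the information plane that maximizers of the IB Lagrangian for `β` occupy. -/
def optimalPoints (p : Measure (X × Y)) (β : ℝ) : Set (ℝ≥0∞ × ℝ≥0∞) :=
  {z | ∃ (T' : Type u) (_ : MeasurableSpace T') (q : Measure (X × Y × T')),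
    IsMaximizer p β q ∧ infoPoint q = z}

/-- The joint law of `(X, Y, g(X))`; for `g = f` this is the law of `(X, Y, T_copy)`. -/
def detLaw (p : Measure (X × Y)) (g : X → T) : Measure (X × Y × T) :=
  p.map fun z => (z.1, z.2, g z.1)

/-- The joint law of `(X, Y, T_α)`, where `T_α = B_α · f(X)` for a Bernoulli variable `B_α`
independent of `(X, Y)` with `P(B_α = 1) = α`: it is `f(X)` with probability `α` and `0` with
probability `1 - α`. -/
def alphaLaw [Zero Y] (p : Measure (X × Y)) (f : X → Y) (α : unitInterval) :
    Measure (X × Y × Y) :=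
  (p.prod (bernoulliMeasure true false α)).map
    fun v => (v.1.1, v.1.2, if v.2 = true then f v.1.1 else 0)

end

end IB

/-! Since `Y = f(X)` almost surely, the Markov condition holds for every `T`, and two bounds govern
everything: data processing gives `I(Y;T) ≤ I(X;T)` (`infoYT_le_infoXT`), and `I(Y;T) ≤ I(Y;Y) =
H(Y)` (`infoYT_le_entropyY`). So every point lies below `min(r, H(Y))`.

The bound is attained by `T_α`. The density of the law of `(X, T_α)` relative to the product of its
marginals depends on `x` only through `f x`, so `I(X;T_α)` and `I(Y;T_α)` are the same explicit
function `erasureInfo` of `α` (`mutualInfo_erasureLaw`). It is continuous, `0` at `0` and `H(Y)` at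
`1`, so by the intermediate value theorem `T_α` sweeps out the whole diagonal segment
(`exists_alpha_of_le`); `α = 1` is `T_copy`.

For the Lagrangian, with `x = I(X;T)` finite and `y = I(Y;T)`, the bounds give `y - βx ≤ (1-β)y ≤
(1-β)H(Y)`, with equality at `T_copy`. Maximizers are thus the cases of equality: for `0 < β < 1`
both steps are tight and only the corner remains, for `β = 1` the condition is `x = y`, for `β = 0`
it is `y = H(Y)`. Both failures of injectivity follow. -/

namespace IB

open Real (negMulLog log)

/-! ### Measures on products with a countable factor -/

section Measure

variable {A B Y : Type*} [MeasurableSpace A] [MeasurableSpace B] [MeasurableSpace Y]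
  [Countable Y] [MeasurableSingletonClass Y]

/-- The fibers of `φ` cut every set into countably many disjoint measurable pieces, so no finiteness
of the measures is needed. -/
lemma measure_ext_of_inter_fiber {μ ν : Measure A} {φ : A → Y} (hφ : Measurable φ)
    (h : ∀ s y, MeasurableSet s → μ (s ∩ φ ⁻¹' {y}) = ν (s ∩ φ ⁻¹' {y})) : μ = ν := by
  ext s hs
  have hU : s = ⋃ y, s ∩ φ ⁻¹' {y} := by ext; simp
  have hd : Pairwise (Function.onFun Disjoint fun y => s ∩ φ ⁻¹' {y}) := by
    intro y y' hy
    refine Set.disjoint_left.2 ?_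
    rintro a ⟨-, ha⟩ ⟨-, ha'⟩
    exact hy (ha.symm.trans ha')
  have hm : ∀ y, MeasurableSet (s ∩ φ ⁻¹' {y}) :=
    fun y => hs.inter (hφ (measurableSet_singleton y))
  rw [hU, measure_iUnion hd hm, measure_iUnion hd hm]
  exact tsum_congr fun y => h s y hs

lemma measure_ext_singleton_prod {μ ν : Measure (Y × A)}
    (h : ∀ y s, MeasurableSet s → μ ({y} ×ˢ s) = ν ({y} ×ˢ s)) : μ = ν := by
  refine measure_ext_of_inter_fiber measurable_fst fun s y hs => ?_
  have : s ∩ Prod.fst ⁻¹' {y} = {y} ×ˢ (Prod.mk y ⁻¹' s) := by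
    ext ⟨a, b⟩
    simp only [mem_inter_iff, mem_preimage, mem_singleton_iff, mem_prod]
    constructor
    · rintro ⟨h, rfl⟩; exact ⟨rfl, h⟩
    · rintro ⟨rfl, h⟩; exact ⟨h, rfl⟩
  rw [this]
  exact h y _ (measurable_prodMk_left hs)

lemma measure_ext_prod_singleton {μ ν : Measure (A × Y)}
    (h : ∀ s y, MeasurableSet s → μ (s ×ˢ {y}) = ν (s ×ˢ {y})) : μ = ν := by
  refine measure_ext_of_inter_fiber measurable_snd fun s y hs => ?_
  have : s ∩ Prod.snd ⁻¹' {y} = ((fun a => (a, y)) ⁻¹' s) ×ˢ {y} := by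
    ext ⟨a, b⟩
    simp only [mem_inter_iff, mem_preimage, mem_singleton_iff, mem_prod]
    constructor
    · rintro ⟨h, rfl⟩; exact ⟨h, rfl⟩
    · rintro ⟨h, rfl⟩; exact ⟨h, rfl⟩
  rw [this]
  exact h _ y (measurable_prodMk_right hs)

/-- Regular conditional distributions given a discrete random variable exist without any
assumption on the space of outcomes. -/
lemma exists_kernel_compProd {Ω : Type*} [MeasurableSpace Ω] (μ : Measure Ω)
    [IsProbabilityMeasure μ] {U : Ω → Y} {V : Ω → A} (hU : Measurable U) (hV : Measurable V) :
    ∃ κ : Kernel Y A, IsMarkovKernel κ ∧ (μ.map U).compProd κ = μ.map fun w => (U w, V w) := by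
  classical
  -- Conditioning on a null atom would give the zero measure; any probability measure serves there
  -- instead, and `μ.map V` is one.
  let k : Y → Measure A := fun y =>
    if μ (U ⁻¹' {y}) = 0 then μ.map V else (ProbabilityTheory.cond μ (U ⁻¹' {y})).map V
  let κ : Kernel Y A := ⟨k, measurable_of_countable k⟩
  have hκ : ∀ y, κ y = if μ (U ⁻¹' {y}) = 0 then μ.map V
    else (ProbabilityTheory.cond μ (U ⁻¹' {y})).map V := fun y => rfl
  have hmk : IsMarkovKernel κ := by
    refine ⟨fun y => ?_⟩
    rw [hκ]
    split_ifs with h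
    · exact Measure.isProbabilityMeasure_map hV.aemeasurable
    · have := cond_isProbabilityMeasure h
      exact Measure.isProbabilityMeasure_map hV.aemeasurable
  have : IsProbabilityMeasure (μ.map U) := Measure.isProbabilityMeasure_map hU.aemeasurable
  refine ⟨κ, hmk, measure_ext_singleton_prod fun y s hs => ?_⟩
  rw [Measure.compProd_apply_prod (measurableSet_singleton y) hs,
    Measure.map_apply (hU.prodMk hV) ((measurableSet_singleton y).prod hs),
    lintegral_singleton, Measure.map_apply hU (measurableSet_singleton y), hκ]
  have hpre : (fun w => (U w, V w)) ⁻¹' ({y} ×ˢ s) = U ⁻¹' {y} ∩ V ⁻¹' s := by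
    ext; simp
  rw [hpre]
  split_ifs with h
  · rw [h, mul_zero]
    exact (measure_mono_null inter_subset_left h).symm
  · rw [Measure.map_apply hV hs, cond_apply (hU (measurableSet_singleton y)), mul_right_comm,
      ENNReal.inv_mul_cancel h (measure_ne_top _ _), one_mul]

end Measure

/-! ### Mutual information and data processing -/

section MutualInfo

variable {Ω A B C D : Type*} [MeasurableSpace Ω] [MeasurableSpace A] [MeasurableSpace B]
  [MeasurableSpace C] [MeasurableSpace D]

lemma mutualInfo_congr_left {μ : Measure Ω} {U U' : Ω → A} {V : Ω → B} (h : U =ᵐ[μ] U') :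
    mutualInfo μ U V = mutualInfo μ U' V := by
  unfold mutualInfo
  rw [Measure.map_congr h, Measure.map_congr (h.mono fun w hw => by
    change (U w, V w) = (U' w, V w); rw [hw])]

lemma mutualInfo_comp_le (μ : Measure Ω) [IsFiniteMeasure μ] {U : Ω → A} {V : Ω → B}
    (hU : Measurable U) (hV : Measurable V) {a : A → C} {b : B → D} (ha : Measurable a)
    (hb : Measurable b) :
    mutualInfo μ (fun w => a (U w)) (fun w => b (V w)) ≤ mutualInfo μ U V := by
  have h := klDiv_map_le (μ.map fun w => (U w, V w)) ((μ.map U).prod (μ.map V))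
    (ha.prodMap hb)
  rw [Measure.map_map (ha.prodMap hb) (hU.prodMk hV), ← Measure.map_prod_map _ _ ha hb,
    Measure.map_map ha hU, Measure.map_map hb hV] at h
  exact h

lemma mutualInfo_map {Ω' : Type*} [MeasurableSpace Ω'] (μ : Measure Ω) {φ : Ω → Ω'}
    (hφ : Measurable φ) {U : Ω' → A} {V : Ω' → B} (hU : Measurable U) (hV : Measurable V) :
    mutualInfo (μ.map φ) U V = mutualInfo μ (fun w => U (φ w)) (fun w => V (φ w)) := by
  unfold mutualInfo
  rw [Measure.map_map (hU.prodMk hV) hφ, Measure.map_map hU hφ, Measure.map_map hV hφ]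
  rfl

/-- A discrete random variable shares with another one at most its self-information. -/
lemma mutualInfo_le_self {Y : Type*} [MeasurableSpace Y] [Countable Y]
    [MeasurableSingletonClass Y] (μ : Measure Ω) [IsProbabilityMeasure μ] {U : Ω → Y} {V : Ω → A}
    (hU : Measurable U) (hV : Measurable V) : mutualInfo μ U V ≤ mutualInfo μ U U := by
  obtain ⟨κ, hκ, h⟩ := exists_kernel_compProd μ hU hV
  have hp : IsProbabilityMeasure (μ.map U) := Measure.isProbabilityMeasure_map hU.aemeasurable
  have hV' : κ ∘ₘ (μ.map U) = μ.map V := by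
    rw [← Measure.snd_compProd, h, Measure.snd, Measure.map_map measurable_snd (hU.prodMk hV)]
    rfl
  have hdiag : μ.map (fun w => (U w, U w)) = Kernel.copy Y ∘ₘ (μ.map U) := by
    rw [Kernel.copy, Measure.deterministic_comp_eq_map,
      Measure.map_map (by exact measurable_id.prodMk measurable_id) hU]
    rfl
  -- Applying `κ` to the second coordinate sends the law of `(U, U)` to that of `(U, V)` and the
  -- product of marginals to the product of marginals; divergence cannot increase.
  have := klDiv_comp_right_le (μ.map fun w => (U w, U w)) ((μ.map U).prod (μ.map U))
    (Kernel.id ∥ₖ κ)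
  rw [← Measure.prod_comp_right, hV', hdiag,
    ← Measure.compProd_eq_parallelComp_comp_copy_comp, h, ← hdiag] at this
  exact this

end MutualInfo

/-! ### Bottleneck variables when `Y` is a function of `X` -/

section Bottleneck

variable {X Y T : Type u} [MeasurableSpace X] [MeasurableSpace Y] [MeasurableSpace T]
  {p : Measure (X × Y)} {q : Measure (X × Y × T)}

lemma IsBottleneck.isProbabilityMeasure [IsProbabilityMeasure p] (hq : IsBottleneck p q) :
    IsProbabilityMeasure q := by
  have hm : Measurable fun w : X × Y × T => (w.1, w.2.1) := by fun_prop
  refine ⟨?_⟩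
  rw [← preimage_univ (f := fun w : X × Y × T => (w.1, w.2.1)),
    ← Measure.map_apply hm .univ, hq.marginal, measure_univ]

lemma ae_eq_of_marginal {f : X → Y} (hYf : ∀ᵐ z ∂p, z.2 = f z.1)
    (hq : q.map (fun w => (w.1, w.2.1)) = p) : ∀ᵐ w ∂q, w.2.1 = f w.1 := by
  have hm : Measurable fun w : X × Y × T => (w.1, w.2.1) := by fun_prop
  rw [← hq] at hYf
  exact ae_of_ae_map hm.aemeasurable hYf

/-- When `Y` is a function of `X`, every `T` satisfies the Markov condition. -/
lemma isBottleneck_of_marginal [IsProbabilityMeasure p] {f : X → Y} (hf : Measurable f)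
    (hYf : ∀ᵐ z ∂p, z.2 = f z.1) (hq : q.map (fun w => (w.1, w.2.1)) = p) :
    IsBottleneck p q := by
  refine ⟨hq, fun B C hB hC => ?_⟩
  have hm : Measurable fun w : X × Y × T => (w.1, w.2.1) := by fun_prop
  have hpq : IsProbabilityMeasure q := by
    refine ⟨?_⟩
    rw [← preimage_univ (f := fun w : X × Y × T => (w.1, w.2.1)),
      ← Measure.map_apply hm .univ, hq, measure_univ]
  have hae := ae_eq_of_marginal hYf hq
  have hCm : MeasurableSet {w : X × Y × T | w.2.2 ∈ C} := measurable_snd.snd hC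
  set m : MeasurableSpace (X × Y × T) := MeasurableSpace.comap Prod.fst inferInstance with hmdef
  have hle : m ≤ Prod.instMeasurableSpace := measurable_fst.comap_le
  -- The event `Y ∈ B` agrees almost everywhere with `S`, which is determined by `X`; its indicator
  -- therefore pulls out of the conditional expectation.
  set S : Set (X × Y × T) := Prod.fst ⁻¹' (f ⁻¹' B)
  have hS : MeasurableSet[m] S := ⟨f ⁻¹' B, hf hB, rfl⟩
  set c : X × Y × T → ℝ := {w | w.2.2 ∈ C}.indicator fun _ => 1
  set b : X × Y × T → ℝ := S.indicator fun _ => 1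
  have hc : Integrable c q := (integrable_const 1).indicator hCm
  have hb : StronglyMeasurable[m] b := stronglyMeasurable_const.indicator hS
  have hbi : Integrable b q := (integrable_const 1).indicator (hle _ hS)
  have hbc : Integrable (b * c) q := by
    have : b * c = (S ∩ {w | w.2.2 ∈ C}).indicator fun _ => 1 := by
      ext w; simp only [b, c, Pi.mul_apply, indicator, mem_inter_iff]; split_ifs <;> simp_all
    rw [this]
    exact (integrable_const 1).indicator ((hle _ hS).inter hCm)
  have h1 : ({w : X × Y × T | w.2.1 ∈ B} ∩ {w | w.2.2 ∈ C}).indicator (fun _ => (1 : ℝ))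
      =ᵐ[q] b * c := by
    filter_upwards [hae] with w hw
    have hiff : w ∈ {w : X × Y × T | w.2.1 ∈ B} ↔ w ∈ S := by
      change w.2.1 ∈ B ↔ f w.1 ∈ B
      rw [hw]
    simp only [b, c, Pi.mul_apply, indicator, mem_inter_iff, hiff]
    split_ifs <;> simp_all
  have h2 : ({w : X × Y × T | w.2.1 ∈ B}).indicator (fun _ => (1 : ℝ)) =ᵐ[q] b := by
    filter_upwards [hae] with w hw
    have hiff : w ∈ {w : X × Y × T | w.2.1 ∈ B} ↔ w ∈ S := by
      change w.2.1 ∈ B ↔ f w.1 ∈ B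
      rw [hw]
    simp only [b, indicator]
    split_ifs <;> tauto
  have h3 := condExp_congr_ae (m := m) h2
  rw [condExp_of_stronglyMeasurable hle hb hbi] at h3
  filter_upwards [condExp_congr_ae (m := m) h1, h3,
    condExp_mul_of_stronglyMeasurable_left hb hbc hc] with w e1 e2 e3
  rw [e1, e3, Pi.mul_apply, Pi.mul_apply, e2]

/-- Data processing: `I(Y;T) ≤ I(X;T)`. -/
lemma infoYT_le_infoXT [IsProbabilityMeasure p] {f : X → Y} (hf : Measurable f)
    (hYf : ∀ᵐ z ∂p, z.2 = f z.1) (hq : IsBottleneck p q) : infoYT q ≤ infoXT q := by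
  have := hq.isProbabilityMeasure
  have h : infoYT q = mutualInfo q (fun w => f w.1) (fun w => w.2.2) :=
    mutualInfo_congr_left (ae_eq_of_marginal hYf hq.marginal)
  rw [h]
  exact mutualInfo_comp_le q measurable_fst measurable_snd.snd hf measurable_id

end Bottleneck

/-! ### Divergence from a density, and entropy as an integral -/

lemma klDiv_withDensity {A : Type*} [MeasurableSpace A] (ν : Measure A) [IsProbabilityMeasure ν]
    {d : A → ℝ≥0∞} (hd : Measurable d) [IsProbabilityMeasure (ν.withDensity d)]
    (hi : Integrable (fun a => log (d a).toReal) (ν.withDensity d)) :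
    klDiv (ν.withDensity d) ν = ENNReal.ofReal (∫ a, log (d a).toReal ∂ν.withDensity d) := by
  have hac : ν.withDensity d ≪ ν := withDensity_absolutelyContinuous ν d
  have h : llr (ν.withDensity d) ν =ᵐ[ν.withDensity d] fun a => log (d a).toReal := by
    filter_upwards [hac.ae_le (Measure.rnDeriv_withDensity ν hd)] with a ha
    rw [llr, ha]
  rw [klDiv_of_ac_of_integrable hac ((integrable_congr h).2 hi), integral_congr_ae h]
  -- Both measures have mass one, so the mass correction in `klDiv` cancels.
  simp

section Entropy

variable {Y : Type*} [MeasurableSpace Y]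

lemma negMulLog_real_nonneg (P : Measure Y) [IsProbabilityMeasure P] (y : Y) :
    0 ≤ negMulLog (P.real {y}) :=
  Real.negMulLog_nonneg measureReal_nonneg measureReal_le_one

variable [Countable Y] [MeasurableSingletonClass Y]

/-- The integral of `|log P{y}|` against `P` is the entropy series itself. -/
lemma integrable_log_real_singleton {P : Measure Y} [IsProbabilityMeasure P]
    (h : ∑' y, ENNReal.ofReal (negMulLog (P.real {y})) ≠ ∞) :
    Integrable (fun y => log (P.real {y})) P := by
  refine ⟨(measurable_of_countable _).aestronglyMeasurable, ?_⟩
  rw [HasFiniteIntegral, lintegral_countable']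
  refine lt_of_eq_of_lt (tsum_congr fun y => ?_) h.lt_top
  rw [← ofReal_norm, Real.norm_of_nonpos (Real.log_nonpos measureReal_nonneg
    measureReal_le_one), ← ofReal_measureReal (measure_ne_top P _),
    ← ENNReal.ofReal_mul' measureReal_nonneg, negMulLog]
  congr 1
  ring

lemma integral_log_real_singleton {P : Measure Y} [IsProbabilityMeasure P]
    (h : ∑' y, ENNReal.ofReal (negMulLog (P.real {y})) ≠ ∞) :
    ∫ y, log (P.real {y}) ∂P = -(∑' y, ENNReal.ofReal (negMulLog (P.real {y}))).toReal := by
  rw [integral_countable (integrable_log_real_singleton h), ENNReal.tsum_toReal_eq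
    (fun _ => ENNReal.ofReal_ne_top), ← tsum_neg]
  refine tsum_congr fun y => ?_
  rw [ENNReal.toReal_ofReal (negMulLog_real_nonneg P y), negMulLog, smul_eq_mul]
  ring

end Entropy

/-! ### The erasure channel and its density -/

section Erasure

/-- The transition probabilities of the erasure channel that keeps its input with probability `a`
and replaces it by `0` otherwise. -/
noncomputable def erasureWeight {Y : Type*} [Zero Y] [DecidableEq Y] (a : ℝ) (y t : Y) : ℝ :=
  (if y = t then a else 0) + (if t = 0 then 1 - a else 0)

lemma erasureWeight_nonneg {Y : Type*} [Zero Y] [DecidableEq Y] (α : unitInterval) (y t : Y) : 0 ≤ erasureWeight (α : ℝ) y t := by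
  have := α.2.1
  have := α.2.2
  unfold erasureWeight
  split_ifs <;> linarith

variable {X Y : Type*} [MeasurableSpace X] [MeasurableSpace Y] [Zero Y]

/-- The law of `(X, T)`, where `T` is `f(X)` with probability `α` and `0` otherwise. -/
noncomputable def erasureLaw (P : Measure X) (f : X → Y) (α : unitInterval) : Measure (X × Y) :=
  (P.prod (bernoulliMeasure true false α)).map fun v => (v.1, if v.2 = true then f v.1 else 0)

lemma erasureLaw_eq (P : Measure X) [IsProbabilityMeasure P] {f : X → Y} (hf : Measurable f)
    (α : unitInterval) :
    erasureLaw P f α = unitInterval.toNNReal α • P.map (fun x => (x, f x)) +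
      unitInterval.toNNReal (unitInterval.symm α) • P.map fun x => (x, 0) := by
  have hm : Measurable fun v : X × Bool => (v.1, if v.2 = true then f v.1 else (0 : Y)) :=
    measurable_fst.prodMk (Measurable.ite (measurable_snd (measurableSet_singleton true))
      (hf.comp measurable_fst) measurable_const)
  rw [erasureLaw, bernoulliMeasure_def, Measure.prod_add, Measure.prod_smul_right,
    Measure.prod_smul_right, Measure.prod_dirac, Measure.prod_dirac, Measure.map_add _ _ hm,
    Measure.map_smul, Measure.map_smul, Measure.map_map hm measurable_prodMk_right,
    Measure.map_map hm measurable_prodMk_right]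
  simp [Function.comp_def]

lemma isProbabilityMeasure_erasureLaw (P : Measure X) [IsProbabilityMeasure P] {f : X → Y}
    (hf : Measurable f) (α : unitInterval) : IsProbabilityMeasure (erasureLaw P f α) := by
  have hm : Measurable fun v : X × Bool => (v.1, if v.2 = true then f v.1 else (0 : Y)) :=
    measurable_fst.prodMk (Measurable.ite (measurable_snd (measurableSet_singleton true))
      (hf.comp measurable_fst) measurable_const)
  exact Measure.isProbabilityMeasure_map hm.aemeasurable

lemma erasureLaw_fst (P : Measure X) [IsProbabilityMeasure P] {f : X → Y}
    (hf : Measurable f) (α : unitInterval) : (erasureLaw P f α).map Prod.fst = P := by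
  have hm : Measurable fun v : X × Bool => (v.1, if v.2 = true then f v.1 else (0 : Y)) :=
    measurable_fst.prodMk (Measurable.ite (measurable_snd (measurableSet_singleton true))
      (hf.comp measurable_fst) measurable_const)
  rw [erasureLaw, Measure.map_map measurable_fst hm]
  exact Measure.fst_prod

/-- The channel sees its input only through `g ∘ h`, so replacing `X` by `h(X)` commutes with
erasing. This transfers results from `(X, Y)` to `X`, and from `X` to `Y`. -/
lemma erasureLaw_map_prodMap (P : Measure X) [IsProbabilityMeasure P] {Z : Type*}
    [MeasurableSpace Z] {g : Z → Y} (hg : Measurable g) {h : X → Z} (hh : Measurable h)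
    (α : unitInterval) :
    (erasureLaw P (fun x => g (h x)) α).map (Prod.map h id) = erasureLaw (P.map h) g α := by
  have hP : IsProbabilityMeasure (P.map h) := Measure.isProbabilityMeasure_map hh.aemeasurable
  rw [erasureLaw_eq _ (by fun_prop), erasureLaw_eq _ hg,
    Measure.map_add _ _ (hh.prodMap measurable_id),
    Measure.map_smul, Measure.map_smul, Measure.map_map (by fun_prop) (by fun_prop),
    Measure.map_map (by fun_prop) (by fun_prop), Measure.map_map (by fun_prop) (by fun_prop),
    Measure.map_map (by fun_prop) (by fun_prop)]
  rfl

variable [DecidableEq Y] [MeasurableSingletonClass Y]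

lemma erasureLaw_apply_prod_singleton (P : Measure X) [IsProbabilityMeasure P] {f : X → Y}
    (hf : Measurable f) (α : unitInterval) {s : Set X} (hs : MeasurableSet s) (t : Y) :
    erasureLaw P f α (s ×ˢ {t}) = ∫⁻ x in s, ENNReal.ofReal (erasureWeight (α : ℝ) (f x) t) ∂P := by
  have h0 := α.2.1
  have h1 := α.2.2
  have e : ∀ x, ENNReal.ofReal (erasureWeight (α : ℝ) (f x) t) =
      ENNReal.ofReal α * (f ⁻¹' {t}).indicator 1 x + ENNReal.ofReal (1 - α) *
        (if t = 0 then 1 else 0) := by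
    intro x
    rw [erasureWeight, ENNReal.ofReal_add (by split_ifs <;> linarith)
      (by split_ifs <;> linarith)]
    congr 1
    · by_cases h : f x = t <;> simp [h]
    · by_cases h : t = 0 <;> simp [h]
  simp_rw [e]
  rw [lintegral_add_right _ measurable_const, lintegral_const_mul _
    (measurable_one.indicator (hf (measurableSet_singleton t))),
    lintegral_indicator_one (hf (measurableSet_singleton t)), lintegral_const,
    Measure.restrict_apply (hf (measurableSet_singleton t)), Measure.restrict_apply_univ,
    erasureLaw_eq P hf, Measure.add_apply, Measure.smul_apply, Measure.smul_apply,
    Measure.map_apply (by fun_prop) (hs.prod (measurableSet_singleton t)),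
    Measure.map_apply (by fun_prop)
      (hs.prod (measurableSet_singleton t))]
  have a0 : ENNReal.ofReal α = (unitInterval.toNNReal α : ℝ≥0∞) := by
    rw [← ENNReal.ofReal_coe_nnreal]; rfl
  have a1 : ENNReal.ofReal (1 - α) = (unitInterval.toNNReal (unitInterval.symm α) : ℝ≥0∞) := by
    rw [← ENNReal.ofReal_coe_nnreal]; rfl
  rw [a0, a1]
  have s1 : (fun x => (x, f x)) ⁻¹' (s ×ˢ {t}) = f ⁻¹' {t} ∩ s := by
    ext; simp [and_comm]
  congr 1
  · rw [ENNReal.smul_def, smul_eq_mul]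
    exact congrArg _ (congrArg P s1)
  · rw [ENNReal.smul_def, smul_eq_mul, mul_assoc]
    congr 1
    by_cases h : t = 0
    · simp only [h, if_true, one_mul]
      congr 1
      ext; simp
    · have : (fun x : X => (x, (0 : Y))) ⁻¹' (s ×ˢ {t}) = ∅ := by
        ext; simp [Ne.symm h]
      simp only [h, if_false, zero_mul]
      exact (congrArg P this).trans measure_empty

variable [Countable Y]

lemma erasureLaw_snd_real (P : Measure X) [IsProbabilityMeasure P] {f : X → Y}
    (hf : Measurable f) (α : unitInterval) (t : Y) :
    ((erasureLaw P f α).map Prod.snd).real {t} =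
      α * (P.map f).real {t} + (if t = 0 then 1 - (α : ℝ) else 0) := by
  have h0 := α.2.1
  have h1 := α.2.2
  have e : Prod.snd ⁻¹' {t} = (univ : Set X) ×ˢ {t} := by ext; simp
  have : Integrable (fun x => (f ⁻¹' {t}).indicator (fun _ => (α : ℝ)) x) P :=
    (integrable_const _).indicator (hf (measurableSet_singleton t))
  rw [measureReal_def, Measure.map_apply measurable_snd (measurableSet_singleton t), e,
    erasureLaw_apply_prod_singleton P hf α .univ, Measure.restrict_univ,
    ← integral_eq_lintegral_of_nonneg_ae (ae_of_all _ fun x => erasureWeight_nonneg α (f x) t)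
      (by
        have : Measurable fun y => erasureWeight (α : ℝ) y t := measurable_of_countable _
        exact (this.comp hf).aestronglyMeasurable)]
  have e2 : ∀ x, erasureWeight (α : ℝ) (f x) t = (f ⁻¹' {t}).indicator (fun _ => (α : ℝ)) x +
      (if t = 0 then 1 - (α : ℝ) else 0) := fun x => by
    simp [erasureWeight, indicator]
  simp_rw [e2]
  rw [integral_add this (integrable_const _), integral_indicator_const _
    (hf (measurableSet_singleton t)), integral_const, map_measureReal_apply hf
    (measurableSet_singleton t)]
  simp [mul_comm]

/-- The density of the law of `(X, T)` with respect to the product of its marginals. -/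
noncomputable def erasureDensity (P : Measure Y) (a : ℝ) (y t : Y) : ℝ :=
  erasureWeight a y t / (a * P.real {t} + (if t = 0 then 1 - a else 0))

/-- Given `X = x`, the mass of `T` at `t` is `erasureWeight`; dividing by the marginal mass of `t`
gives the density. -/
lemma erasureLaw_eq_withDensity (P : Measure X) [IsProbabilityMeasure P] {f : X → Y}
    (hf : Measurable f) (α : unitInterval) :
    erasureLaw P f α = (P.prod ((erasureLaw P f α).map Prod.snd)).withDensity
      fun z => ENNReal.ofReal (erasureDensity (P.map f) α (f z.1) z.2) := by
  have := isProbabilityMeasure_erasureLaw P hf α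
  have hR : IsProbabilityMeasure ((erasureLaw P f α).map Prod.snd) :=
    Measure.isProbabilityMeasure_map measurable_snd.aemeasurable
  refine measure_ext_prod_singleton fun s t hs => ?_
  have hw : Measurable fun x => ENNReal.ofReal (erasureWeight (α : ℝ) (f x) t) :=
    (measurable_of_countable fun y => ENNReal.ofReal (erasureWeight (α : ℝ) y t)).comp hf
  have hd : Measurable fun z : X × Y =>
      ENNReal.ofReal (erasureDensity (P.map f) α (f z.1) z.2) :=
    (measurable_of_countable fun w : Y × Y =>
      ENNReal.ofReal (erasureDensity (P.map f) α w.1 w.2)).comp (hf.prodMap measurable_id)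
  rw [withDensity_apply _ (hs.prod (measurableSet_singleton t)), ← Measure.prod_restrict,
    lintegral_prod _ hd.aemeasurable]
  simp_rw [lintegral_singleton]
  rw [erasureLaw_apply_prod_singleton P hf α hs]
  set R := (erasureLaw P f α).map Prod.snd with hRdef
  have hr : α * (P.map f).real {t} + (if t = 0 then 1 - (α : ℝ) else 0) = R.real {t} :=
    (erasureLaw_snd_real P hf α t).symm
  -- Here the density is a division by zero, but the weight of `t` integrates to `R {t} = 0`, so
  -- both sides vanish.
  by_cases h : R {t} = 0
  · have hz : ∫⁻ x, ENNReal.ofReal (erasureWeight (α : ℝ) (f x) t) ∂P = 0 := by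
      have e : Prod.snd ⁻¹' {t} = (univ : Set X) ×ˢ {t} := by ext; simp
      rw [hRdef, Measure.map_apply measurable_snd (measurableSet_singleton t), e,
        erasureLaw_apply_prod_singleton P hf α .univ, Measure.restrict_univ] at h
      exact h
    simp only [h, mul_zero, lintegral_zero]
    exact le_antisymm ((setLIntegral_le_lintegral _ _).trans hz.le) bot_le
  · refine lintegral_congr fun x => ?_
    have hpos : 0 < R.real {t} := ENNReal.toReal_pos h (measure_ne_top _ _)
    rw [erasureDensity, hr, ← ofReal_measureReal (measure_ne_top R {t}),
      ← ENNReal.ofReal_mul' measureReal_nonneg, div_mul_cancel₀ _ hpos.ne']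

end Erasure

/-! ### Mutual information across the erasure channel -/

section ErasureInfo

/-- The mutual information between a discrete variable with law `Q` and its image under the erasure
channel with parameter `a`. -/
noncomputable def erasureInfo {Y : Type*} [MeasurableSpace Y] [Zero Y] (Q : Measure Y) (a : ℝ) : ℝ :=
  a * ((∑' y, ENNReal.ofReal (negMulLog (Q.real {y}))).toReal - negMulLog (Q.real {0})) +
    negMulLog (1 - a * (1 - Q.real {0})) - (1 - Q.real {0}) * negMulLog (1 - a)

lemma continuous_erasureInfo {Y : Type*} [MeasurableSpace Y] [Zero Y] (Q : Measure Y) :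
    Continuous (erasureInfo Q) := by
  unfold erasureInfo
  fun_prop

lemma erasureInfo_zero {Y : Type*} [MeasurableSpace Y] [Zero Y] (Q : Measure Y) :
    erasureInfo Q 0 = 0 := by
  simp [erasureInfo]

lemma erasureInfo_one {Y : Type*} [MeasurableSpace Y] [Zero Y] (Q : Measure Y) :
    erasureInfo Q 1 = (∑' y, ENNReal.ofReal (negMulLog (Q.real {y}))).toReal := by
  simp [erasureInfo]

variable {X Y : Type*} [MeasurableSpace X] [MeasurableSpace Y] [Zero Y]

/-- For `y ≠ 0` the factor `a` cancels between weight and marginal, leaving the self-information of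
`y`. At `a = 0` the quotient is `0 / 0 = 0`, with logarithm `0`. -/
lemma log_erasureDensity_self [DecidableEq Y] (Q : Measure Y) (a : ℝ) (y : Y) :
    log (erasureDensity Q a y y) = if y = 0 then -log (1 - a * (1 - Q.real {0}))
      else if a = 0 then 0 else -log (Q.real {y}) := by
  have e : a * Q.real {0} + (1 - a) = 1 - a * (1 - Q.real {0}) := by ring
  unfold erasureDensity erasureWeight
  by_cases h0 : y = 0
  · simp only [h0, if_true, e]
    rw [show a + (1 - a) = 1 by ring, one_div, Real.log_inv]
  · by_cases ha : a = 0
    · simp [h0, ha]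
    · simp only [h0, ha, if_true, if_false, add_zero]
      rw [← Real.log_inv, div_mul_cancel_left₀ ha]

lemma log_erasureDensity_zero [DecidableEq Y] (Q : Measure Y) (a : ℝ) (y : Y) :
    log (erasureDensity Q a y 0) = if y = 0 then -log (1 - a * (1 - Q.real {0}))
      else log ((1 - a) / (1 - a * (1 - Q.real {0}))) := by
  have e : a * Q.real {0} + (1 - a) = 1 - a * (1 - Q.real {0}) := by ring
  unfold erasureDensity erasureWeight
  simp only [if_true, e]
  split_ifs with h0
  · rw [show a + (1 - a) = 1 by ring, one_div, Real.log_inv]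
  · rw [zero_add]

lemma erasureDensity_nonneg [DecidableEq Y] (Q : Measure Y) (α : unitInterval) (y t : Y) :
    0 ≤ erasureDensity Q (α : ℝ) y t := by
  have h0 := α.2.1
  have h1 := α.2.2
  refine div_nonneg (erasureWeight_nonneg α y t) (add_nonneg (mul_nonneg h0 measureReal_nonneg) ?_)
  split_ifs <;> linarith

variable [Countable Y] [MeasurableSingletonClass Y]

lemma integrable_log_erasureDensity_self [DecidableEq Y] {Q : Measure Y} [IsProbabilityMeasure Q]
    (h : ∑' y, ENNReal.ofReal (negMulLog (Q.real {y})) ≠ ∞) (a : ℝ) :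
    Integrable (fun y => log (erasureDensity Q a y y)) Q := by
  refine ((integrable_const |log (1 - a * (1 - Q.real {0}))|).add
    (integrable_log_real_singleton h).abs).mono'
    (measurable_of_countable _).aestronglyMeasurable (ae_of_all _ fun y => ?_)
  have h1 := abs_nonneg (log (1 - a * (1 - Q.real {0})))
  have h2 := abs_nonneg (log (Q.real {y}))
  rw [log_erasureDensity_self, Real.norm_eq_abs, Pi.add_apply]
  split_ifs
  · rw [abs_neg]; linarith
  · rw [abs_zero]; linarith
  · rw [abs_neg]; linarith

lemma integrable_log_erasureDensity_zero [DecidableEq Y] (Q : Measure Y) [IsProbabilityMeasure Q]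
    (a : ℝ) : Integrable (fun y => log (erasureDensity Q a y 0)) Q := by
  refine Integrable.of_bound (measurable_of_countable _).aestronglyMeasurable
    (|log (1 - a * (1 - Q.real {0}))| + |log ((1 - a) / (1 - a * (1 - Q.real {0})))|)
    (ae_of_all _ fun y => ?_)
  have h1 := abs_nonneg (log (1 - a * (1 - Q.real {0})))
  have h2 := abs_nonneg (log ((1 - a) / (1 - a * (1 - Q.real {0}))))
  rw [log_erasureDensity_zero, Real.norm_eq_abs]
  split_ifs
  · rw [abs_neg]; linarith
  · linarith

/-- The two integrals are the expected log-density given that the input is kept or erased. The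
result is `H(T) - H(T|Y)`, in which the `negMulLog a` terms cancel. -/
lemma integral_log_erasureDensity [DecidableEq Y] {Q : Measure Y} [IsProbabilityMeasure Q]
    (h : ∑' y, ENNReal.ofReal (negMulLog (Q.real {y})) ≠ ∞) (α : unitInterval) :
    (α : ℝ) * ∫ y, log (erasureDensity Q α y y) ∂Q +
      (1 - α) * ∫ y, log (erasureDensity Q α y 0) ∂Q = erasureInfo Q α := by
  obtain ⟨a, h0, h1⟩ := α
  simp only
  have hq0 : (0 : ℝ) ≤ Q.real {0} := measureReal_nonneg
  set c := 1 - a * (1 - Q.real {0}) with hc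
  set C := (1 - a) * (log (1 - a) - log c) with hC
  -- `k` corrects the generic integrand `-a * log (Q.real {y}) + C` at the single point `y = 0`,
  -- where keeping and erasing give the same output.
  set k := -log c + a * log (Q.real {0}) - C with hk
  have hpt : ∀ y, a * log (erasureDensity Q a y y) + (1 - a) * log (erasureDensity Q a y 0) =
      (-a * log (Q.real {y}) + C) + ({0} : Set Y).indicator (fun _ => k) y := by
    intro y
    rw [log_erasureDensity_self, log_erasureDensity_zero, ← hc]
    by_cases hy : y = 0
    · simp only [hy, if_true, mem_singleton_iff, indicator_of_mem, hk]
      ring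
    · have e1 : a * (if a = 0 then 0 else -log (Q.real {y})) = -a * log (Q.real {y}) := by
        split_ifs with ha <;> simp [ha]
      -- At `a = 1` the constant `c` may be `0`, but the prefactor vanishes; for `a < 1` one has `c
      -- ≥ 1 - a > 0`.
      have e2 : (1 - a) * log ((1 - a) / c) = C := by
        rcases eq_or_lt_of_le h1 with rfl | hlt
        · simp [hC]
        · have hcpos : 0 < c := by
            rw [hc]; nlinarith
          rw [Real.log_div (by linarith) hcpos.ne', hC]
      simp only [hy, if_false, mem_singleton_iff, not_false_eq_true, indicator_of_notMem, e1, e2,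
        add_zero]
  have hlog := integrable_log_real_singleton h
  have hind : Integrable (({0} : Set Y).indicator fun _ => k) Q :=
    (integrable_const k).indicator (measurableSet_singleton 0)
  rw [← integral_const_mul, ← integral_const_mul,
    ← integral_add ((integrable_log_erasureDensity_self h a).const_mul _)
      ((integrable_log_erasureDensity_zero Q a).const_mul _)]
  simp_rw [hpt]
  rw [integral_add (f := fun y => -a * log (Q.real {y}) + C)
      ((hlog.const_mul _).add (integrable_const _)) hind,
    integral_add (hlog.const_mul _) (integrable_const _), integral_const_mul,
    integral_log_real_singleton h, integral_const,
    integral_indicator_const _ (measurableSet_singleton _), erasureInfo, ← hc]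
  simp only [probReal_univ, smul_eq_mul, negMulLog, hk, hC]
  -- The terms in `log c` have total coefficient `-c` and make up `negMulLog c`.
  linear_combination log c * hc

/-- The value depends on `P` only through `P.map f`; using it for `X` with `f` and for `Y` with `id`
gives equal information. -/
theorem mutualInfo_erasureLaw (P : Measure X) [IsProbabilityMeasure P] {f : X → Y}
    (hf : Measurable f) (α : unitInterval)
    (h : ∑' y, ENNReal.ofReal (negMulLog ((P.map f).real {y})) ≠ ∞) :
    mutualInfo (erasureLaw P f α) Prod.fst Prod.snd =
      ENNReal.ofReal (erasureInfo (P.map f) α) := by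
  classical
  have hQ : IsProbabilityMeasure (P.map f) := Measure.isProbabilityMeasure_map hf.aemeasurable
  have hμ := isProbabilityMeasure_erasureLaw P hf α
  have hR : IsProbabilityMeasure ((erasureLaw P f α).map Prod.snd) :=
    Measure.isProbabilityMeasure_map measurable_snd.aemeasurable
  have hd := erasureLaw_eq_withDensity P hf α
  set ν := P.prod ((erasureLaw P f α).map Prod.snd) with hν
  have hm : Measurable fun z : X × Y => ENNReal.ofReal (erasureDensity (P.map f) α (f z.1) z.2) :=
    (measurable_of_countable fun w : Y × Y =>
      ENNReal.ofReal (erasureDensity (P.map f) α w.1 w.2)).comp (hf.prodMap measurable_id)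
  have hpw : IsProbabilityMeasure (ν.withDensity fun z =>
      ENNReal.ofReal (erasureDensity (P.map f) α (f z.1) z.2)) := hd ▸ hμ
  have hlm : Measurable fun z : X × Y => log (erasureDensity (P.map f) α (f z.1) z.2) :=
    (measurable_of_countable fun w : Y × Y =>
      log (erasureDensity (P.map f) α w.1 w.2)).comp (hf.prodMap measurable_id)
  have e : ∀ z : X × Y, log (ENNReal.ofReal (erasureDensity (P.map f) α (f z.1) z.2)).toReal =
      log (erasureDensity (P.map f) α (f z.1) z.2) := fun z => by
    rw [ENNReal.toReal_ofReal (erasureDensity_nonneg _ _ _ _)]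
  have i1 : Integrable (fun z => log (erasureDensity (P.map f) α (f z.1) z.2))
      (P.map fun x => (x, f x)) := by
    rw [integrable_map_measure hlm.aestronglyMeasurable (by fun_prop)]
    exact (integrable_log_erasureDensity_self h α).comp_measurable hf
  have i2 : Integrable (fun z => log (erasureDensity (P.map f) α (f z.1) z.2))
      (P.map fun x => (x, 0)) := by
    rw [integrable_map_measure hlm.aestronglyMeasurable (by fun_prop)]
    exact (integrable_log_erasureDensity_zero (P.map f) α).comp_measurable hf
  have key : mutualInfo (erasureLaw P f α) Prod.fst Prod.snd = klDiv (erasureLaw P f α) ν := by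
    rw [mutualInfo, erasureLaw_fst P hf]
    congr 1
    exact Measure.map_id
  have hi : Integrable (fun z => log (erasureDensity (P.map f) α (f z.1) z.2))
      (erasureLaw P f α) := by
    rw [erasureLaw_eq P hf]
    exact i1.smul_measure_nnreal.add_measure i2.smul_measure_nnreal
  have hkl := klDiv_withDensity ν hm (by simp_rw [e]; rwa [← hd])
  simp_rw [e] at hkl
  rw [← hd] at hkl
  rw [key, hkl, ← integral_log_erasureDensity h α,
    integral_map hf.aemeasurable (measurable_of_countable _).aestronglyMeasurable,
    integral_map hf.aemeasurable (measurable_of_countable _).aestronglyMeasurable,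
    erasureLaw_eq P hf, integral_add_measure i1.smul_measure_nnreal i2.smul_measure_nnreal,
    integral_smul_nnreal_measure, integral_smul_nnreal_measure,
    integral_map (by fun_prop) hlm.aestronglyMeasurable,
    integral_map (by fun_prop) hlm.aestronglyMeasurable]
  rfl

end ErasureInfo

/-! ### The shape of the IB curve -/

section Curve

variable {X Y T : Type u} [MeasurableSpace X] [MeasurableSpace Y] [MeasurableSpace T]
  {p : Measure (X × Y)} {q : Measure (X × Y × T)} {f : X → Y}

lemma map_fst_map_eq (hf : Measurable f) (hYf : ∀ᵐ z ∂p, z.2 = f z.1) :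
    (p.map Prod.fst).map f = p.map Prod.snd := by
  rw [Measure.map_map hf measurable_fst]
  exact Measure.map_congr (hYf.mono fun z hz => hz.symm)

lemma isBottleneck_detLaw [IsProbabilityMeasure p] (hf : Measurable f)
    (hYf : ∀ᵐ z ∂p, z.2 = f z.1) {g : X → T} (hg : Measurable g) :
    IsBottleneck p (detLaw p g) := by
  refine isBottleneck_of_marginal hf hYf ?_
  rw [detLaw, Measure.map_map (by fun_prop) (by fun_prop)]
  exact Measure.map_id

section Alpha

variable [Zero Y]

lemma measurable_alpha (hf : Measurable f) : Measurable fun v : (X × Y) × Bool =>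
    (v.1.1, v.1.2, if v.2 = true then f v.1.1 else (0 : Y)) :=
  (measurable_fst.comp measurable_fst).prodMk ((measurable_snd.comp measurable_fst).prodMk
    (Measurable.ite (measurable_snd (measurableSet_singleton true))
      (hf.comp (measurable_fst.comp measurable_fst)) measurable_const))

lemma isBottleneck_alphaLaw [IsProbabilityMeasure p] (hf : Measurable f)
    (hYf : ∀ᵐ z ∂p, z.2 = f z.1) (α : unitInterval) : IsBottleneck p (alphaLaw p f α) := by
  refine isBottleneck_of_marginal hf hYf ?_
  rw [alphaLaw, Measure.map_map (by fun_prop) (measurable_alpha hf)]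
  exact Measure.fst_prod

lemma alphaLaw_map_fst_snd [IsProbabilityMeasure p] (hf : Measurable f) (α : unitInterval) :
    (alphaLaw p f α).map (fun w => (w.1, w.2.2)) = erasureLaw (p.map Prod.fst) f α := by
  rw [← erasureLaw_map_prodMap p hf measurable_fst, erasureLaw, alphaLaw,
    Measure.map_map (by fun_prop) (measurable_alpha hf), Measure.map_map (by fun_prop)]
  · rfl
  · exact measurable_fst.prodMk (Measurable.ite (measurable_snd (measurableSet_singleton true))
      (hf.comp (measurable_fst.comp measurable_fst)) measurable_const)

/-- This makes `I(Y;Y) = H(Y)` the endpoint `α = 1` of the erasure computation. -/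
lemma detLaw_eq_alphaLaw [IsProbabilityMeasure p] (hf : Measurable f) :
    detLaw p f = alphaLaw p f 1 := by
  rw [detLaw, alphaLaw, bernoulliMeasure_one, Measure.prod_dirac,
    Measure.map_map (measurable_alpha hf) (by fun_prop)]
  rfl

lemma ofReal_erasureInfo_one (hH : entropyY p ≠ ∞) :
    ENNReal.ofReal (erasureInfo (p.map Prod.snd) 1) = entropyY p := by
  rw [erasureInfo_one]
  exact ENNReal.ofReal_toReal hH

lemma exists_alpha_of_le
    (hH : entropyY p ≠ ∞) {r : ℝ≥0∞}
    (hr : r ≤ entropyY p) :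
    ∃ α : unitInterval, ENNReal.ofReal (erasureInfo (p.map Prod.snd) α) = r := by
  have hr' : r ≠ ∞ := ne_top_of_le_ne_top hH hr
  have h := intermediate_value_Icc (zero_le_one' ℝ)
    (continuous_erasureInfo (p.map Prod.snd)).continuousOn
  rw [erasureInfo_zero, erasureInfo_one] at h
  obtain ⟨a, ha, e⟩ := h ⟨ENNReal.toReal_nonneg, ENNReal.toReal_mono hH hr⟩
  exact ⟨⟨a, ha⟩, by rw [e, ENNReal.ofReal_toReal hr']⟩

variable [Countable Y] [MeasurableSingletonClass Y]

lemma infoXT_alphaLaw [IsProbabilityMeasure p] (hf : Measurable f)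
    (hYf : ∀ᵐ z ∂p, z.2 = f z.1) (hH : entropyY p ≠ ∞) (α : unitInterval) :
    infoXT (alphaLaw p f α) = ENNReal.ofReal (erasureInfo (p.map Prod.snd) α) := by
  have hP : IsProbabilityMeasure (p.map Prod.fst) :=
    Measure.isProbabilityMeasure_map measurable_fst.aemeasurable
  rw [← map_fst_map_eq hf hYf, ← mutualInfo_erasureLaw (p.map Prod.fst) hf α
    (by rw [map_fst_map_eq hf hYf]; exact hH), ← alphaLaw_map_fst_snd hf,
    mutualInfo_map _ (by fun_prop) measurable_fst measurable_snd]
  rfl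

lemma infoYT_alphaLaw [IsProbabilityMeasure p] (hf : Measurable f)
    (hYf : ∀ᵐ z ∂p, z.2 = f z.1) (hH : entropyY p ≠ ∞) (α : unitInterval) :
    infoYT (alphaLaw p f α) = ENNReal.ofReal (erasureInfo (p.map Prod.snd) α) := by
  have hP : IsProbabilityMeasure (p.map Prod.fst) :=
    Measure.isProbabilityMeasure_map measurable_fst.aemeasurable
  have hQ : IsProbabilityMeasure (p.map Prod.snd) :=
    Measure.isProbabilityMeasure_map measurable_snd.aemeasurable
  have hid : (p.map Prod.snd).map id = p.map Prod.snd := Measure.map_id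
  have h1 : infoYT (alphaLaw p f α) =
      mutualInfo (alphaLaw p f α) (fun w => f w.1) (fun w => w.2.2) :=
    mutualInfo_congr_left (ae_eq_of_marginal hYf (isBottleneck_alphaLaw hf hYf α).marginal)
  have h2 : (alphaLaw p f α).map (fun w => (f w.1, w.2.2)) =
      erasureLaw (p.map Prod.snd) id α := by
    rw [← map_fst_map_eq hf hYf, ← erasureLaw_map_prodMap (p.map Prod.fst) measurable_id hf α]
    change _ = (erasureLaw (p.map Prod.fst) f α).map _
    rw [← alphaLaw_map_fst_snd hf, Measure.map_map (by fun_prop) (by fun_prop)]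
    rfl
  have h3 := mutualInfo_erasureLaw (p.map Prod.snd) measurable_id α (by rw [hid]; exact hH)
  rw [hid, ← h2, mutualInfo_map _ (by fun_prop) measurable_fst measurable_snd] at h3
  exact h1.trans h3

lemma infoPoint_detLaw [IsProbabilityMeasure p] (hf : Measurable f)
    (hYf : ∀ᵐ z ∂p, z.2 = f z.1) (hH : entropyY p ≠ ∞) :
    infoPoint (detLaw p f) = (entropyY p, entropyY p) := by
  rw [infoPoint, detLaw_eq_alphaLaw hf, infoXT_alphaLaw hf hYf hH, infoYT_alphaLaw hf hYf hH,
    Set.Icc.coe_one, ofReal_erasureInfo_one hH]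

lemma infoYT_le_entropyY [IsProbabilityMeasure p] (hf : Measurable f)
    (hYf : ∀ᵐ z ∂p, z.2 = f z.1) (hH : entropyY p ≠ ∞) (hq : IsBottleneck p q) :
    infoYT q ≤ entropyY p := by
  have := hq.isProbabilityMeasure
  refine (mutualInfo_le_self q (by fun_prop) (by fun_prop)).trans_eq ?_
  have h1 : mutualInfo q (fun w => w.2.1) (fun w => w.2.1) =
      mutualInfo p Prod.snd Prod.snd := by
    have h := mutualInfo_map q (φ := fun w : X × Y × T => (w.1, w.2.1)) (by fun_prop)
      (U := Prod.snd) (V := Prod.snd) (by fun_prop) (by fun_prop)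
    rw [hq.marginal] at h
    exact h.symm
  have h2 : infoYT (detLaw p f) = mutualInfo p Prod.snd fun z => f z.1 :=
    mutualInfo_map p (by fun_prop) (by fun_prop) (by fun_prop)
  -- `I(Y;Y) = I(Y;f(X))`, which is already known from `T_copy`.
  have h3 : mutualInfo p Prod.snd Prod.snd = mutualInfo p Prod.snd fun z => f z.1 := by
    unfold mutualInfo
    rw [Measure.map_congr (f := Prod.snd) (g := fun z : X × Y => f z.1) hYf,
      Measure.map_congr (f := fun z : X × Y => (z.2, z.2)) (g := fun z : X × Y => (z.2, f z.1))
        (hYf.mono fun z hz => by simp only [hz])]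
  rw [h1, h3, ← h2]
  exact congrArg Prod.snd (infoPoint_detLaw hf hYf hH)

theorem curveFun_eq [IsProbabilityMeasure p] (hf : Measurable f)
    (hYf : ∀ᵐ z ∂p, z.2 = f z.1) (hH : entropyY p ≠ ∞) (r : ℝ≥0∞) :
    curveFun p r = min r (entropyY p) := by
  refine le_antisymm ?_ ?_
  · exact iSup_le fun T => iSup_le fun _ => iSup_le fun q => iSup_le fun hq => iSup_le fun hr =>
      le_min ((infoYT_le_infoXT hf hYf hq).trans hr) (infoYT_le_entropyY hf hYf hH hq)
  · obtain ⟨α, hα⟩ := exists_alpha_of_le hH (min_le_right r (entropyY p))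
    have hX := (infoXT_alphaLaw hf hYf hH α).trans hα
    have hY := (infoYT_alphaLaw hf hYf hH α).trans hα
    rw [← hY]
    exact le_iSup_of_le Y <| le_iSup_of_le inferInstance <| le_iSup_of_le (alphaLaw p f α) <|
      le_iSup_of_le (isBottleneck_alphaLaw hf hYf α) <|
      le_iSup_of_le (hX.trans_le (min_le_left _ _)) le_rfl

lemma increasingPart_eq [IsProbabilityMeasure p] (hf : Measurable f)
    (hYf : ∀ᵐ z ∂p, z.2 = f z.1) (hH : entropyY p ≠ ∞) :
    increasingPart p = {z | z.1 = z.2 ∧ z.1 ≤ entropyY p} := by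
  ext ⟨a, b⟩
  simp only [increasingPart, curve, mem_ofPred_eq, curveFun_eq hf hYf hH]
  constructor
  · rintro ⟨⟨-, h⟩, hl⟩
    exact ⟨by rw [h, min_eq_left hl], hl⟩
  · rintro ⟨h, hl⟩
    exact ⟨⟨ne_top_of_le_ne_top hH hl, by rw [min_eq_left hl, h]⟩, hl⟩

lemma range_infoPoint_alphaLaw [IsProbabilityMeasure p] (hf : Measurable f)
    (hYf : ∀ᵐ z ∂p, z.2 = f z.1) (hH : entropyY p ≠ ∞) :
    range (fun α : unitInterval => infoPoint (alphaLaw p f α)) = increasingPart p := by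
  rw [increasingPart_eq hf hYf hH]
  ext ⟨a, b⟩
  constructor
  · rintro ⟨α, h⟩
    have hX := infoXT_alphaLaw hf hYf hH α
    have hY := infoYT_alphaLaw hf hYf hH α
    obtain ⟨rfl, rfl⟩ := Prod.mk.inj h
    refine ⟨hX.trans hY.symm, ?_⟩
    exact (hX.trans hY.symm).trans_le
      (infoYT_le_entropyY hf hYf hH (isBottleneck_alphaLaw hf hYf α))
  · rintro ⟨h, hl⟩
    obtain rfl : a = b := h
    obtain ⟨α, hα⟩ := exists_alpha_of_le hH hl
    exact ⟨α, Prod.ext ((infoXT_alphaLaw hf hYf hH α).trans hα)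
      ((infoYT_alphaLaw hf hYf hH α).trans hα)⟩

lemma infoPoint_detLaw_comp [IsProbabilityMeasure p] (hf : Measurable f)
    (hYf : ∀ᵐ z ∂p, z.2 = f z.1) (hH : entropyY p ≠ ∞) [MeasurableSingletonClass T] {g : Y → T}
    (hg : Function.Injective g) : infoPoint (detLaw p (g ∘ f)) = (entropyY p, entropyY p) := by
  have hgm : Measurable g := measurable_of_countable g
  -- Images under `g` are countable, hence measurable, so `g` has a measurable left inverse and data
  -- processing applies in both directions.
  have hge : MeasurableEmbedding g :=
    ⟨hg, hgm, fun {s} _ => (s.to_countable.image g).measurableSet⟩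
  have : Nonempty Y := ⟨0⟩
  have hinv : Measurable hge.invFun := hge.measurable_invFun
  have hl : ∀ y, hge.invFun (g y) = y := hge.leftInverse_invFun
  rw [← infoPoint_detLaw hf hYf hH]
  have key : ∀ {A : Type u} [MeasurableSpace A] {U : X × Y → A}, Measurable U →
      mutualInfo p U (fun z => g (f z.1)) = mutualInfo p U fun z => f z.1 := by
    intro A _ U hU
    refine le_antisymm (mutualInfo_comp_le p hU (by fun_prop) measurable_id hgm) ?_
    have h := mutualInfo_comp_le p hU (V := fun z => g (f z.1)) (by fun_prop) measurable_id hinv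
    simpa only [hl, id_eq] using h
  have hX : ∀ {A : Type u} [MeasurableSpace A] {k : X → A}, Measurable k →
      infoXT (detLaw p k) = mutualInfo p Prod.fst fun z => k z.1 := fun hk =>
    mutualInfo_map p (by fun_prop) (by fun_prop) (by fun_prop)
  have hY : ∀ {A : Type u} [MeasurableSpace A] {k : X → A}, Measurable k →
      infoYT (detLaw p k) = mutualInfo p Prod.snd fun z => k z.1 := fun hk =>
    mutualInfo_map p (by fun_prop) (by fun_prop) (by fun_prop)
  rw [infoPoint, infoPoint, hX hf, hY hf, hX (hgm.comp hf), hY (hgm.comp hf)]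
  exact Prod.ext (key measurable_fst) (key measurable_snd)

end Alpha

end Curve

/-! ### The Lagrangian and its maximizers -/

section Lagrangian

variable {X Y T : Type u} [MeasurableSpace X] [MeasurableSpace Y] [MeasurableSpace T]
  {p : Measure (X × Y)} {q : Measure (X × Y × T)} {β : ℝ}

lemma lagrangian_of_ne_top (hx : infoXT q ≠ ∞) (hy : infoYT q ≠ ∞) :
    lagrangian β q = (((infoYT q).toReal - β * (infoXT q).toReal : ℝ) : EReal) := by
  rw [lagrangian, ← EReal.coe_ennreal_toReal hx, ← EReal.coe_ennreal_toReal hy]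
  norm_cast

lemma lagrangian_of_infoXT_eq_top (hβ : 0 < β) (hx : infoXT q = ∞) : lagrangian β q = ⊥ := by
  rw [lagrangian, hx, EReal.coe_ennreal_top, EReal.coe_mul_top_of_pos hβ, EReal.sub_top]

lemma lagrangian_zero : lagrangian 0 q = infoYT q := by
  simp [lagrangian]

end Lagrangian

section Maximizer

variable {X Y T : Type u} [MeasurableSpace X] [MeasurableSpace Y] [MeasurableSpace T]
  [Countable Y] [MeasurableSingletonClass Y] [Zero Y]
  {p : Measure (X × Y)} {q : Measure (X × Y × T)} {f : X → Y} {β : ℝ}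

lemma lagrangian_detLaw [IsProbabilityMeasure p] (hf : Measurable f)
    (hYf : ∀ᵐ z ∂p, z.2 = f z.1) (hH : entropyY p ≠ ∞) (β : ℝ) :
    lagrangian β (detLaw p f) = (((1 - β) * (entropyY p).toReal : ℝ) : EReal) := by
  obtain ⟨hx, hy⟩ := Prod.mk.inj (infoPoint_detLaw hf hYf hH)
  rw [lagrangian_of_ne_top (hx ▸ hH) (hy ▸ hH), hx, hy]
  congr 1
  ring

lemma lagrangian_le [IsProbabilityMeasure p] (hf : Measurable f)
    (hYf : ∀ᵐ z ∂p, z.2 = f z.1) (hH : entropyY p ≠ ∞) (hβ : β ∈ Icc (0 : ℝ) 1)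
    (hq : IsBottleneck p q) :
    lagrangian β q ≤ (((1 - β) * (entropyY p).toReal : ℝ) : EReal) := by
  have hy := infoYT_le_entropyY hf hYf hH hq
  have hyt := ne_top_of_le_ne_top hH hy
  -- `β = 0` is separate because `I(X;T) = ∞` then does not force the value `⊥`.
  rcases eq_or_lt_of_le hβ.1 with rfl | h0
  · rw [lagrangian_zero, sub_zero, one_mul, EReal.coe_ennreal_toReal hH]
    exact_mod_cast hy
  by_cases hx : infoXT q = ∞
  · rw [lagrangian_of_infoXT_eq_top h0 hx]
    exact bot_le
  · rw [lagrangian_of_ne_top hx hyt, EReal.coe_le_coe_iff]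
    have h1 := ENNReal.toReal_mono hx (infoYT_le_infoXT hf hYf hq)
    have h2 := ENNReal.toReal_mono hH hy
    nlinarith [hβ.2]

/-- `T_copy` is an admissible competitor attaining the upper bound, so maximizing means attaining
it. -/
lemma isMaximizer_iff [IsProbabilityMeasure p] (hf : Measurable f)
    (hYf : ∀ᵐ z ∂p, z.2 = f z.1) (hH : entropyY p ≠ ∞) (hβ : β ∈ Icc (0 : ℝ) 1)
    (hq : IsBottleneck p q) : IsMaximizer p β q ↔
      lagrangian β q = (((1 - β) * (entropyY p).toReal : ℝ) : EReal) := by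
  constructor
  · intro h
    refine le_antisymm (lagrangian_le hf hYf hH hβ hq) ?_
    rw [← lagrangian_detLaw hf hYf hH]
    exact h.2 Y (detLaw p f) (isBottleneck_detLaw hf hYf hf)
  · intro h
    exact ⟨hq, fun T' _ q' hq' => (lagrangian_le hf hYf hH hβ hq').trans h.ge⟩

lemma isMaximizer_of_infoPoint_eq [IsProbabilityMeasure p] (hf : Measurable f)
    (hYf : ∀ᵐ z ∂p, z.2 = f z.1) (hH : entropyY p ≠ ∞) (hβ : β ∈ Icc (0 : ℝ) 1)
    (hq : IsBottleneck p q) (h : infoPoint q = (entropyY p, entropyY p)) :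
    IsMaximizer p β q := by
  obtain ⟨hx, hy⟩ := Prod.mk.inj h
  rw [isMaximizer_iff hf hYf hH hβ hq, lagrangian_of_ne_top (hx ▸ hH) (hy ▸ hH), hx, hy]
  congr 1
  ring

lemma infoPoint_eq_of_isMaximizer [IsProbabilityMeasure p] (hf : Measurable f)
    (hYf : ∀ᵐ z ∂p, z.2 = f z.1) (hH : entropyY p ≠ ∞) (hβ : β ∈ Ioo (0 : ℝ) 1)
    (h : IsMaximizer p β q) : infoPoint q = (entropyY p, entropyY p) := by
  have hL := (isMaximizer_iff hf hYf hH ⟨hβ.1.le, hβ.2.le⟩ h.1).1 h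
  have hy := infoYT_le_entropyY hf hYf hH h.1
  have hxy := infoYT_le_infoXT hf hYf h.1
  have hyt := ne_top_of_le_ne_top hH hy
  have hx : infoXT q ≠ ∞ := by
    intro hx
    rw [lagrangian_of_infoXT_eq_top hβ.1 hx] at hL
    exact EReal.bot_ne_coe _ hL
  rw [lagrangian_of_ne_top hx hyt, EReal.coe_eq_coe_iff] at hL
  have h1 := ENNReal.toReal_mono hx hxy
  have h2 := ENNReal.toReal_mono hH hy
  -- From `y - βx = (1-β)H(Y)` and `y ≤ x` one gets `(1-β)H(Y) ≤ (1-β)y`; cancelling needs `β < 1`,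
  -- and recovering `x` afterwards needs `β > 0`.
  have e2 : (infoYT q).toReal = (entropyY p).toReal := by
    refine le_antisymm h2 (le_of_mul_le_mul_left ?_ (sub_pos.2 hβ.2))
    nlinarith [mul_le_mul_of_nonneg_left h1 hβ.1.le]
  have e1 : (infoXT q).toReal = (entropyY p).toReal := by
    rw [e2] at hL
    exact mul_left_cancel₀ hβ.1.ne' (by linarith)
  exact Prod.ext ((ENNReal.toReal_eq_toReal_iff' hx hH).1 e1)
    ((ENNReal.toReal_eq_toReal_iff' hyt hH).1 e2)

lemma optimalPoints_eq_singleton [IsProbabilityMeasure p] (hf : Measurable f)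
    (hYf : ∀ᵐ z ∂p, z.2 = f z.1) (hH : entropyY p ≠ ∞) (hβ : β ∈ Ioo (0 : ℝ) 1) :
    optimalPoints p β = {(entropyY p, entropyY p)} := by
  ext z
  constructor
  · rintro ⟨T, _, q, hq, rfl⟩
    exact infoPoint_eq_of_isMaximizer hf hYf hH hβ hq
  · rintro rfl
    have hp := infoPoint_detLaw hf hYf hH
    exact ⟨Y, _, detLaw p f, isMaximizer_of_infoPoint_eq hf hYf hH ⟨hβ.1.le, hβ.2.le⟩
      (isBottleneck_detLaw hf hYf hf) hp, hp⟩

lemma isMaximizer_one_iff [IsProbabilityMeasure p] (hf : Measurable f)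
    (hYf : ∀ᵐ z ∂p, z.2 = f z.1) (hH : entropyY p ≠ ∞) (hq : IsBottleneck p q) :
    IsMaximizer p 1 q ↔ infoXT q = infoYT q := by
  have hyt := ne_top_of_le_ne_top hH (infoYT_le_entropyY hf hYf hH hq)
  rw [isMaximizer_iff hf hYf hH (by simp) hq]
  by_cases hx : infoXT q = ∞
  · rw [lagrangian_of_infoXT_eq_top one_pos hx, hx]
    exact iff_of_false (EReal.bot_ne_coe _) hyt.symm
  · rw [lagrangian_of_ne_top hx hyt, EReal.coe_eq_coe_iff,
      ← ENNReal.toReal_eq_toReal_iff' hx hyt, sub_self, zero_mul, one_mul, sub_eq_zero, eq_comm]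

lemma isMaximizer_zero_iff [IsProbabilityMeasure p] (hf : Measurable f)
    (hYf : ∀ᵐ z ∂p, z.2 = f z.1) (hH : entropyY p ≠ ∞) (hq : IsBottleneck p q) :
    IsMaximizer p 0 q ↔ infoYT q = entropyY p := by
  rw [isMaximizer_iff hf hYf hH (by simp) hq, lagrangian_zero, sub_zero, one_mul,
    EReal.coe_ennreal_toReal hH, EReal.coe_ennreal_eq_coe_ennreal_iff]

lemma increasingPart_subset_optimalPoints [IsProbabilityMeasure p] (hf : Measurable f)
    (hYf : ∀ᵐ z ∂p, z.2 = f z.1) (hH : entropyY p ≠ ∞) :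
    increasingPart p ⊆ optimalPoints p 1 := by
  rw [← range_infoPoint_alphaLaw hf hYf hH]
  rintro _ ⟨α, rfl⟩
  have hX := infoXT_alphaLaw hf hYf hH α
  have hY := infoYT_alphaLaw hf hYf hH α
  exact ⟨Y, _, alphaLaw p f α, (isMaximizer_one_iff hf hYf hH
    (isBottleneck_alphaLaw hf hYf α)).2 (hX.trans hY.symm), rfl⟩

/-- Away from the corner, the points of the increasing part are optimal for `β = 1` only. -/
lemma eq_one_of_mem_optimalPoints [IsProbabilityMeasure p] (hf : Measurable f)
    (hYf : ∀ᵐ z ∂p, z.2 = f z.1) (hH : entropyY p ≠ ∞) (hβ : β ∈ Icc (0 : ℝ) 1)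
    {z : ℝ≥0∞ × ℝ≥0∞} (hz : z ∈ optimalPoints p β) (hne : z.2 ≠ entropyY p) : β = 1 := by
  by_contra h1
  have hlt := lt_of_le_of_ne hβ.2 h1
  rcases eq_or_lt_of_le hβ.1 with rfl | h0
  · obtain ⟨T, _, q, hq, rfl⟩ := hz
    exact hne ((isMaximizer_zero_iff hf hYf hH hq.1).1 hq)
  · rw [optimalPoints_eq_singleton hf hYf hH ⟨h0, hlt⟩] at hz
    exact hne (congrArg Prod.snd hz)

end Maximizer

end IB

theorem mainTheorem2 {X Y : Type u} [MeasurableSpace X] [MeasurableSpace Y]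
    [Countable Y] [MeasurableSingletonClass Y] [Zero Y]
    (p : Measure (X × Y)) [IsProbabilityMeasure p]
    (f : X → Y) (hf : Measurable f) (hYf : ∀ᵐ z ∂p, z.2 = f z.1)
    (hH : IB.entropyY p ≠ ∞) :
    -- shape of the curve
    (∀ r : ℝ≥0∞, IB.curveFun p r = min r (IB.entropyY p)) ∧
    -- `T_copy` sits at the corner of the curve and is a maximizer for every `β ∈ [0, 1]`
    IB.infoPoint (IB.detLaw p f) = (IB.entropyY p, IB.entropyY p) ∧
    (∀ β ∈ Icc (0 : ℝ) 1,
      IB.IsMaximizer p β (IB.detLaw p f) ∧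
      IB.lagrangian β (IB.detLaw p f) = ((1 - β : ℝ) : EReal) * (IB.entropyY p : EReal)) ∧
    -- so is every one-to-one transformation of `T_copy`
    (∀ (T : Type u) [MeasurableSpace T] [MeasurableSingletonClass T] (g : Y → T),
      Function.Injective g →
        IB.infoPoint (IB.detLaw p (g ∘ f)) = (IB.entropyY p, IB.entropyY p) ∧
        ∀ β ∈ Icc (0 : ℝ) 1, IB.IsMaximizer p β (IB.detLaw p (g ∘ f))) ∧
    -- for `0 < β < 1` only the corner is recovered
    (∀ β ∈ Ioo (0 : ℝ) 1, IB.optimalPoints p β = {(IB.entropyY p, IB.entropyY p)}) ∧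
    -- `β = 1`
    (∀ (T : Type u) [MeasurableSpace T] (q : Measure (X × Y × T)), IB.IsBottleneck p q →
      (IB.IsMaximizer p 1 q ↔ IB.infoXT q = IB.infoYT q)) ∧
    (∀ (T : Type u) [MeasurableSpace T] (q : Measure (X × Y × T)), IB.OnCurve p q →
      IB.infoXT q ≤ IB.entropyY p → IB.IsMaximizer p 1 q) ∧
    (∀ α : unitInterval, IB.IsMaximizer p 1 (IB.alphaLaw p f α) ∧
      IB.OnCurve p (IB.alphaLaw p f α)) ∧
    range (fun α : unitInterval => IB.infoPoint (IB.alphaLaw p f α)) = IB.increasingPart p ∧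
    IB.increasingPart p ⊆ IB.optimalPoints p 1 ∧
    -- `β = 0`
    (∀ (T : Type u) [MeasurableSpace T] (q : Measure (X × Y × T)), IB.IsBottleneck p q →
      (IB.IsMaximizer p 0 q ↔ IB.infoYT q = IB.entropyY p)) ∧
    (∀ (T : Type u) [MeasurableSpace T] (q : Measure (X × Y × T)), IB.OnCurve p q →
      IB.entropyY p ≤ IB.infoXT q → IB.IsMaximizer p 0 q) ∧
    -- no one-to-one correspondence: maximizers for distinct `β` cannot occupy distinct points, and
    -- distinct points of the curve cannot be obtained from distinct `β`
    (¬ ∃ z : ℝ → ℝ≥0∞ × ℝ≥0∞, InjOn z (Icc 0 1) ∧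
      ∀ β ∈ Icc (0 : ℝ) 1, z β ∈ IB.optimalPoints p β) ∧
    (IB.entropyY p ≠ 0 →
      ¬ ∃ b : ℝ≥0∞ × ℝ≥0∞ → ℝ, InjOn b (IB.increasingPart p) ∧
        ∀ z ∈ IB.increasingPart p, b z ∈ Icc (0 : ℝ) 1 ∧ z ∈ IB.optimalPoints p (b z)) := by
  have hI : ∀ {β : ℝ}, β ∈ Ioo (0 : ℝ) 1 → β ∈ Icc (0 : ℝ) 1 := fun h => ⟨h.1.le, h.2.le⟩
  have hXY : ∀ α, IB.infoXT (IB.alphaLaw p f α) = IB.infoYT (IB.alphaLaw p f α) := fun α =>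
    (IB.infoXT_alphaLaw hf hYf hH α).trans (IB.infoYT_alphaLaw hf hYf hH α).symm
  refine ⟨IB.curveFun_eq hf hYf hH, IB.infoPoint_detLaw hf hYf hH, fun β hβ => ⟨?_, ?_⟩,
    fun T _ _ g hg => ⟨IB.infoPoint_detLaw_comp hf hYf hH hg, fun β hβ => ?_⟩,
    fun β hβ => IB.optimalPoints_eq_singleton hf hYf hH hβ,
    fun T _ q hq => IB.isMaximizer_one_iff hf hYf hH hq, fun T _ q hq hle => ?_,
    fun α => ⟨?_, IB.isBottleneck_alphaLaw hf hYf α, ?_⟩,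
    IB.range_infoPoint_alphaLaw hf hYf hH, IB.increasingPart_subset_optimalPoints hf hYf hH,
    fun T _ q hq => IB.isMaximizer_zero_iff hf hYf hH hq, fun T _ q hq hle => ?_, ?_, ?_⟩
  · exact IB.isMaximizer_of_infoPoint_eq hf hYf hH hβ (IB.isBottleneck_detLaw hf hYf hf)
      (IB.infoPoint_detLaw hf hYf hH)
  · rw [IB.lagrangian_detLaw hf hYf hH, EReal.coe_mul, EReal.coe_ennreal_toReal hH]
  · exact IB.isMaximizer_of_infoPoint_eq hf hYf hH hβ
      (IB.isBottleneck_detLaw hf hYf ((measurable_of_countable g).comp hf))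
      (IB.infoPoint_detLaw_comp hf hYf hH hg)
  · rw [IB.isMaximizer_one_iff hf hYf hH hq.1, hq.2, IB.curveFun_eq hf hYf hH, min_eq_left hle]
  · exact (IB.isMaximizer_one_iff hf hYf hH (IB.isBottleneck_alphaLaw hf hYf α)).2 (hXY α)
  · rw [IB.curveFun_eq hf hYf hH, hXY, min_eq_left]
    exact IB.infoYT_le_entropyY hf hYf hH (IB.isBottleneck_alphaLaw hf hYf α)
  · rw [IB.isMaximizer_zero_iff hf hYf hH hq.1, hq.2, IB.curveFun_eq hf hYf hH, min_eq_right hle]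
  -- All `β` in the open interval share the corner; two of them contradict injectivity.
  · rintro ⟨z, hz, hzo⟩
    have h : ∀ β ∈ Ioo (0 : ℝ) 1, z β = (IB.entropyY p, IB.entropyY p) := fun β hβ => by
      have := hzo β (hI hβ)
      rwa [IB.optimalPoints_eq_singleton hf hYf hH hβ] at this
    have h2 : (1 / 2 : ℝ) ∈ Ioo (0 : ℝ) 1 := by norm_num
    have h3 : (1 / 3 : ℝ) ∈ Ioo (0 : ℝ) 1 := by norm_num
    have := hz (hI h2) (hI h3) ((h _ h2).trans (h _ h3).symm)
    norm_num at this
  · rintro h0 ⟨b, hb, hbo⟩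
    have hinc := IB.increasingPart_eq hf hYf hH
    -- Any two points below the corner force `β = 1`; the origin and the midpoint are distinct
    -- because `H(Y) > 0`.
    have hlt : IB.entropyY p / 2 < IB.entropyY p := ENNReal.half_lt_self h0 hH
    have m0 : ((0, 0) : ℝ≥0∞ × ℝ≥0∞) ∈ IB.increasingPart p := by
      rw [hinc]
      exact ⟨rfl, bot_le⟩
    have m1 : (IB.entropyY p / 2, IB.entropyY p / 2) ∈ IB.increasingPart p := by
      rw [hinc]
      exact ⟨rfl, hlt.le⟩
    have e0 := IB.eq_one_of_mem_optimalPoints hf hYf hH (hbo _ m0).1 (hbo _ m0).2 h0.symm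
    have e1 := IB.eq_one_of_mem_optimalPoints hf hYf hH (hbo _ m1).1 (hbo _ m1).2 hlt.ne
    have := congrArg Prod.fst (hb m0 m1 (e0.trans e1.symm))
    exact (ENNReal.half_pos h0).ne this
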